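/- Let $\mathcal X=\{x\in\mathbb R^2:\|x\|=1\}$, let $\mathcal P$ be the uniform distribution on $\mathcal X$, and let $\mathbb C=\{x\mapsto 2\,\mathbb 1[w\cdot x\ge 0]-1 : w\in\mathbb R^2,\ \|w\|=1\}$ be the class of homogeneous linear separators. Let $X_1,X_2,\ldots$ be independent with distribution $\mathcal P$. A learning algorithm produces, on each round $t\ge 1$, a classifier $\hat h_t:\mathcal X\to\{-1,+1\}$ (not necessarily in $\mathbb C$) from the observations $(X_1,Y_1),\ldots,(X_{t-1},Y_{t-1})$ and possibly from internal randomness independent of $X_1,X_2,\ldots$, and predicts $\hat Y_t=\hat h_t(X_t)$; here $Y_t=h^*_t(X_t)$ for a fixed, nonrandom sequence $\mathbf h^*=(h^*_t)_{t\ge 1}$ of target functions. (Algorithms are measurable maps; no computability is required.) For a sequence $\boldsymbol\Delta=(\Delta_t)_{t\ge 2}$ in $[0,1]$, let $S_{\boldsymbol\Delta}$ be the set of all sequences $\mathbf h^*$ in $\mathbb C$ such that $\mathcal P(x: h^*_t(x)\ne h^*_{t+1}(x))\le\Delta_{t+1}$ for every $t\ge 1$. Then, for every such $\boldsymbol\Delta$,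 there exists an algorithm (which may depend on $\boldsymbol\Delta$) such that $$\mathbb E\Big[\sum_{t=1}^T \mathbb 1[\hat Y_t\ne Y_t]\Big]=o(T)\qquad\text{for every } \mathbf h^*\in S_{\boldsymbol\Delta}$$ if and only if $\sum_{t=1}^T\Delta_t=o(T)$ (where $\Delta_1$ is an arbitrary real number, which does not affect the condition). This equivalence holds both when "algorithm" means deterministic algorithm and when internal randomness is allowed. -/

import Mathlib

open MeasureTheory Set Filter Asymptotics

universe u

/-- The instance space: the unit circle `{x ∈ ℝ² : ‖x‖ = 1}` (Euclidean norm). -/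
abbrev UnitCircle : Type := Metric.sphere (0 : EuclideanSpace ℝ (Fin 2)) 1

/-- The point `(cos θ, sin θ)` of the unit circle. -/
noncomputable def circlePoint (θ : ℝ) : UnitCircle :=
  ⟨!₂[Real.cos θ, Real.sin θ], by
    simp [EuclideanSpace.norm_eq, Fin.sum_univ_two]⟩

theorem continuous_circlePoint : Continuous circlePoint := by
  unfold circlePoint
  refine Continuous.subtype_mk ?_ _
  refine (PiLp.continuous_toLp 2 _).comp (continuous_pi fun i => ?_)
  fin_cases i
  · exact Real.continuous_cos
  · exact Real.continuous_sin

/-- The uniform distribution on the unit circle (normalized arc length): the law of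
`(cos θ, sin θ)` for an angle `θ` uniformly distributed on `(-π, π]`. -/
noncomputable def circleUniform : Measure UnitCircle :=
  ((ENNReal.ofReal (2 * Real.pi))⁻¹ •
    (volume : Measure ℝ).restrict (Ioc (-Real.pi) Real.pi)).map circlePoint

instance isProbabilityMeasure_circleUniform : IsProbabilityMeasure circleUniform := by
  constructor
  rw [circleUniform, Measure.map_apply continuous_circlePoint.measurable MeasurableSet.univ]
  have h : Real.pi - -Real.pi = 2 * Real.pi := by ring
  simp only [preimage_univ, Measure.smul_apply, Measure.restrict_apply_univ, Real.volume_Ioc,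
    smul_eq_mul, h]
  exact ENNReal.inv_mul_cancel
    (by simpa using Real.pi_pos) ENNReal.ofReal_ne_top

/-- The homogeneous linear separator `x ↦ 2 · 𝟙[w · x ≥ 0] - 1`. -/
noncomputable def linearSeparator (w : EuclideanSpace ℝ (Fin 2)) (x : UnitCircle) : ℤ :=
  open Classical in 2 * (if 0 ≤ inner ℝ w (x : EuclideanSpace ℝ (Fin 2)) then 1 else 0) - 1

/-- The concept space of homogeneous linear separators. -/
def linearSeparators : Set (UnitCircle → ℤ) :=
  {h | ∃ w : EuclideanSpace ℝ (Fin 2), ‖w‖ = 1 ∧ h = linearSeparator w}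

/-- `S_Δ`: sequences of targets `h 1, h 2, …` in the concept space `C` with
`P(x : h t x ≠ h (t+1) x) ≤ Δ (t+1)` for all `t ≥ 1`. (The entry `h 0` plays no role.) -/
def driftClass {X : Type*} [MeasurableSpace X] (P : Measure X) (C : Set (X → ℤ)) (Δ : ℕ → ℝ) :
    Set (ℕ → X → ℤ) :=
  {h | (∀ t, 1 ≤ t → h t ∈ C) ∧ ∀ t, 1 ≤ t → P.real {x | h t x ≠ h (t + 1) x} ≤ Δ (t + 1)}

/-- A (passive, online) learning algorithm over the instance space `X`, with labels `±1` and
internal randomness in `Ω`. On round `t ≥ 1`, from the internal random seed and the observations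
`(X₁, Y₁), …, (X_{t-1}, Y_{t-1})`, it produces a classifier, which is applied to `X_t`. -/
structure Learner (X : Type*) [MeasurableSpace X] (Ω : Type u) [MeasurableSpace Ω] where
  /-- the classifier produced on round `t`, as a function of the seed and the observations -/
  classifier : (t : ℕ) → Ω → (Finset.Ico 1 t → X × ℤ) → X → ℤ
  classifier_label : ∀ t ω z x, classifier t ω z x = 1 ∨ classifier t ω z x = -1
  measurable_classifier : ∀ t, Measurable
    (fun p : Ω × (Finset.Ico 1 t → X × ℤ) × X => classifier t p.1 p.2.1 p.2.2)

/-- The prediction `Ŷ_t` on the data stream `x` labeled by the targets `h`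
(so that `Y_i = h i (x i)`), with seed `ω`. -/
def Learner.prediction {X : Type*} [MeasurableSpace X] {Ω : Type u} [MeasurableSpace Ω]
    (A : Learner X Ω) (h : ℕ → X → ℤ) (ω : Ω) (x : ℕ → X) (t : ℕ) : ℤ :=
  A.classifier t ω (fun i => (x i, h i (x i))) (x t)

/-- The expected number of mistakes `E[∑_{t=1}^T 𝟙[Ŷ_t ≠ Y_t]]`, for independent `P`-distributed
`X₁, X₂, …` and an independent internal random seed with distribution `ν`. -/
noncomputable def Learner.expectedMistakes {X : Type*} [MeasurableSpace X] {Ω : Type u}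
    [MeasurableSpace Ω] (A : Learner X Ω) (ν : Measure Ω) (P : Measure X) [IsProbabilityMeasure P]
    (h : ℕ → X → ℤ) (T : ℕ) : ℝ :=
  ∫ p : Ω × (ℕ → X), ∑ t ∈ Finset.Icc 1 T,
    (if A.prediction h p.1 p.2 t ≠ h t (p.2 t) then (1 : ℝ) else 0)
    ∂(ν.prod (Measure.infinitePi fun _ : ℕ => P))

/-- The algorithm `A` makes `o(T)` mistakes in expectation for every target sequence in `S`. -/
def Learner.SublinearMistakes {X : Type*} [MeasurableSpace X] {Ω : Type u} [MeasurableSpace Ω]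
    (A : Learner X Ω) (ν : Measure Ω) (P : Measure X) [IsProbabilityMeasure P]
    (S : Set (ℕ → X → ℤ)) : Prop :=
  ∀ h ∈ S, (fun T : ℕ => A.expectedMistakes ν P h T) =o[atTop] (fun T : ℕ => (T : ℝ))

/-!
A linear separator of the circle is given by the angle of its normal vector, and rotating this
vector by `πδ` changes the separator on a set of probability `δ`
(`circleUniform_real_linearSeparator_ne`). So `Δ` bounds the speed at which the angle may move.

*Sublinear drift suffices.* Cut the circle into `k` equal arcs and predict for a point the latest
label seen in its arc. By the intermediate value theorem a separator is constant on all but two of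
the arcs (`exists_exceptional_arcs`), so for any `m` an error on round `t` needs one of three things:
the point lies in one of these two arcs (probability `2/k`), its arc was not visited in the last `m`
rounds (probability `(1 - 1/k) ^ m`), or one of the last `m` labels contradicts the current target
(probability at most `m` times the drift over these rounds). Summing over `t ≤ T`, with `k = k_t`
nondecreasing in `t`, gives `arcLearner_expectedMistakes_le`. With `m = k_T ^ 2` this is `o(T)` as
soon as `k_T → ∞` so slowly that `k_T ^ 4 * (1 + ∑_{t ≤ T} Δ_t) = o(T)`, which is possible when the
total drift is `o(T)`. The learner ignores its seed, so it serves both halves of the theorem.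

*Sublinear drift is necessary.* Let the angle advance by `πΔ_t` or stay, according to independent
fair coins. Whatever the learner does, flipping the `t`-th coin does not affect its prediction on
round `t`, but changes the target there with probability `Δ_t`; hence it errs with probability at
least `Δ_t / 2` on average over the coins. If it made `o(T)` mistakes for every outcome of the
coins, dominated convergence would give the same on average, whence `∑_{t ≤ T} Δ_t = o(T)`
(`isLittleO_drift_of_sublinearMistakes`).
-/

/-! ### Geometry of the circle -/

theorem circlePoint_arg (x : UnitCircle) :
    circlePoint (Complex.arg ⟨x.1 0, x.1 1⟩) = x := by
  have hx : ‖(⟨x.1 0, x.1 1⟩ : ℂ)‖ = 1 := by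
    have h := norm_eq_of_mem_sphere x
    rw [EuclideanSpace.norm_eq, Fin.sum_univ_two] at h
    rw [Complex.norm_eq_sqrt_sq_add_sq]
    simpa using h
  have h0 : (⟨x.1 0, x.1 1⟩ : ℂ) ≠ 0 := by
    intro h
    rw [h] at hx
    simp at hx
  apply Subtype.ext
  ext i
  fin_cases i
  · simp [circlePoint, Complex.cos_arg h0, hx]
  · simp [circlePoint, Complex.sin_arg, hx]

theorem inner_circlePoint_circlePoint (a θ : ℝ) :
    inner ℝ (circlePoint a : EuclideanSpace ℝ (Fin 2)) (circlePoint θ) = Real.cos (θ - a) := by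
  simp [circlePoint, EuclideanSpace.inner_eq_star_dotProduct, Real.cos_sub]

theorem circlePoint_add_two_pi (θ : ℝ) : circlePoint (θ + 2 * Real.pi) = circlePoint θ := by
  simp [circlePoint]

/-- The uniform distribution can be read off on any window of angles of length `2π`. The
window is open: its endpoints are null and would be a special case in the applications. -/
theorem circleUniform_real_eq (c : ℝ) {S : Set UnitCircle} (hS : MeasurableSet S) :
    circleUniform.real S =
      (2 * Real.pi)⁻¹ * volume.real (circlePoint ⁻¹' S ∩ Ioo c (c + 2 * Real.pi)) := by
  have hS' : MeasurableSet (circlePoint ⁻¹' S) := continuous_circlePoint.measurable hS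
  have h2 : volume (circlePoint ⁻¹' S ∩ Ioc (-Real.pi) Real.pi) =
      volume (circlePoint ⁻¹' S ∩ Ioc c (c + 2 * Real.pi)) := by
    have e : Ioc (-Real.pi) Real.pi = Ioc (-Real.pi) (-Real.pi + 2 * Real.pi) := by
      congr 1; ring
    rw [e]
    refine (isAddFundamentalDomain_Ioc Real.two_pi_pos (-Real.pi)).measure_set_eq
      (isAddFundamentalDomain_Ioc Real.two_pi_pos c) hS' ?_
    rintro ⟨g, hg⟩
    obtain ⟨n, rfl⟩ := AddSubgroup.mem_zmultiples_iff.1 hg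
    have hp : Function.Periodic circlePoint (2 * Real.pi) := circlePoint_add_two_pi
    ext θ
    simp only [mem_preimage, AddSubgroup.vadd_def, vadd_eq_add]
    rw [add_comm, hp.zsmul n θ]
  have h3 : volume (circlePoint ⁻¹' S ∩ Ioc c (c + 2 * Real.pi)) =
      volume (circlePoint ⁻¹' S ∩ Ioo c (c + 2 * Real.pi)) :=
    measure_congr ((ae_eq_refl _).inter Ioo_ae_eq_Ioc.symm)
  rw [measureReal_def, circleUniform, Measure.map_apply continuous_circlePoint.measurable hS,
    Measure.smul_apply, Measure.restrict_apply hS', h2, h3, smul_eq_mul, ENNReal.toReal_mul,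
    ENNReal.toReal_inv, ENNReal.toReal_ofReal Real.two_pi_pos.le, measureReal_def]

theorem measurable_uncurry_linearSeparator :
    Measurable fun p : EuclideanSpace ℝ (Fin 2) × UnitCircle => linearSeparator p.1 p.2 := by
  have hm : Measurable fun p : EuclideanSpace ℝ (Fin 2) × UnitCircle =>
      inner ℝ p.1 (p.2 : EuclideanSpace ℝ (Fin 2)) :=
    (measurable_fst).inner (measurable_subtype_coe.comp measurable_snd)
  unfold linearSeparator
  refine Measurable.sub (Measurable.mul measurable_const ?_) measurable_const
  exact Measurable.ite (measurableSet_le measurable_const hm) measurable_const measurable_const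

theorem measurable_linearSeparator (w : EuclideanSpace ℝ (Fin 2)) :
    Measurable (linearSeparator w) :=
  (measurable_uncurry_linearSeparator.comp (measurable_prodMk_left (x := w)) :)

theorem linearSeparator_eq_one_or (w : EuclideanSpace ℝ (Fin 2)) (x : UnitCircle) :
    linearSeparator w x = 1 ∨ linearSeparator w x = -1 := by
  unfold linearSeparator
  split_ifs <;> simp

theorem linearSeparator_eq_iff (w w' : EuclideanSpace ℝ (Fin 2)) (x x' : UnitCircle) :
    linearSeparator w x = linearSeparator w' x' ↔
      (0 ≤ inner ℝ w (x : EuclideanSpace ℝ (Fin 2)) ↔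
        0 ≤ inner ℝ w' (x' : EuclideanSpace ℝ (Fin 2))) := by
  unfold linearSeparator
  split_ifs with h1 h2 h2 <;> simp [h1, h2]

/-- Rotating a separator by the angle `πδ`, with `δ ∈ [0, 1]`, changes it on a set of
probability exactly `δ`. -/
theorem circleUniform_real_linearSeparator_ne (a : ℝ) {δ : ℝ} (h0 : 0 ≤ δ) (h1 : δ ≤ 1) :
    circleUniform.real {x | linearSeparator (circlePoint a) x ≠
      linearSeparator (circlePoint (a + Real.pi * δ)) x} = δ := by
  have hS : MeasurableSet {x | linearSeparator (circlePoint a) x ≠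
      linearSeparator (circlePoint (a + Real.pi * δ)) x} :=
    (measurableSet_eq_fun (measurable_linearSeparator _) (measurable_linearSeparator _)).compl
  have hpi := Real.pi_pos
  have hδ : Real.pi * δ ≤ Real.pi := by nlinarith
  have hδ0 : 0 ≤ Real.pi * δ := by positivity
  -- In the window starting where the first separator becomes `1`, the endpoint removed on the right
  -- matters only for `δ = 1`.
  have key : circlePoint ⁻¹' {x | linearSeparator (circlePoint a) x ≠
      linearSeparator (circlePoint (a + Real.pi * δ)) x} ∩
        Ioo (a - Real.pi / 2) (a - Real.pi / 2 + 2 * Real.pi) =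
      (Ioo (a - Real.pi / 2) (a - Real.pi / 2 + Real.pi * δ) ∪
        Ioc (a + Real.pi / 2) (a + Real.pi / 2 + Real.pi * δ)) \
          {a - Real.pi / 2 + 2 * Real.pi} := by
    ext θ
    simp only [mem_inter_iff, mem_preimage, mem_ofPred_eq, ne_eq, linearSeparator_eq_iff,
      inner_circlePoint_circlePoint, mem_Ioo, Set.mem_sdiff, mem_union, mem_Ioc, mem_singleton_iff]
    constructor
    · rintro ⟨h, hl, hr⟩
      refine ⟨?_, by linarith⟩
      by_contra hcon
      push Not at hcon
      apply h
      have hl' : a - Real.pi / 2 + Real.pi * δ ≤ θ := hcon.1 hl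
      by_cases hθ : θ ≤ a + Real.pi / 2
      · exact iff_of_true (Real.cos_nonneg_of_neg_pi_div_two_le_of_le (by linarith) (by linarith))
          (Real.cos_nonneg_of_neg_pi_div_two_le_of_le (by linarith) (by linarith))
      · have := hcon.2 (by linarith)
        exact iff_of_false
          (Real.cos_neg_of_pi_div_two_lt_of_lt (by linarith) (by linarith)).not_ge
          (Real.cos_neg_of_pi_div_two_lt_of_lt (by linarith) (by linarith)).not_ge
    · rintro ⟨⟨hl, hr⟩ | ⟨hl, hr⟩, hne⟩
      · refine ⟨fun h => ?_, hl, by linarith⟩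
        have h' := h.1 (Real.cos_nonneg_of_neg_pi_div_two_le_of_le (by linarith) (by linarith))
        rw [← Real.cos_neg] at h'
        exact (Real.cos_neg_of_pi_div_two_lt_of_lt (by linarith) (by linarith)).not_ge h'
      · have hr' : θ < a - Real.pi / 2 + 2 * Real.pi :=
          lt_of_le_of_ne (by linarith) hne
        refine ⟨fun h => ?_, by linarith, hr'⟩
        have h' := h.2 (Real.cos_nonneg_of_neg_pi_div_two_le_of_le (by linarith) (by linarith))
        exact (Real.cos_neg_of_pi_div_two_lt_of_lt (by linarith) (by linarith)).not_ge h'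
  have hd : Disjoint (Ioo (a - Real.pi / 2) (a - Real.pi / 2 + Real.pi * δ))
      (Ioc (a + Real.pi / 2) (a + Real.pi / 2 + Real.pi * δ)) := by
    rw [Set.disjoint_left]
    rintro θ ⟨_, h⟩ ⟨h', _⟩
    linarith
  rw [circleUniform_real_eq (a - Real.pi / 2) hS, key, measureReal_def,
    measure_sdiff_null (by simp), measure_union hd measurableSet_Ioc, Real.volume_Ioo,
    Real.volume_Ioc, ← ENNReal.ofReal_add (by linarith) (by linarith),
    ENNReal.toReal_ofReal (by linarith)]
  field_simp
  ring

/-! ### Equal arcs -/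

/-- The index in `{1, …, k}` of the arc containing `x`, when the circle is cut into `k` arcs of
equal length: the `j`-th arc consists of the points whose angle in `(-π, π]` lies in
`(-π + 2π(j-1)/k, -π + 2πj/k]`. -/
noncomputable def arcIndex (k : ℕ) (x : UnitCircle) : ℕ :=
  ⌈(Complex.arg ⟨x.1 0, x.1 1⟩ + Real.pi) / (2 * Real.pi) * k⌉₊

theorem measurable_arcIndex (k : ℕ) : Measurable (arcIndex k) := by
  have h : Continuous fun x : UnitCircle => (⟨x.1 0, x.1 1⟩ : ℂ) :=
    Complex.equivRealProdCLM.symm.continuous.comp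
      (by fun_prop : Continuous fun x : UnitCircle => (x.1 0, x.1 1))
  exact Nat.measurable_ceil.comp (((Complex.measurable_arg.comp h.measurable).add_const _
    |>.div_const _).mul_const _)

theorem arcIndex_circlePoint (k : ℕ) {θ : ℝ} (h : θ ∈ Ioc (-Real.pi) Real.pi) :
    arcIndex k (circlePoint θ) = ⌈(θ + Real.pi) / (2 * Real.pi) * k⌉₊ := by
  have : (⟨Real.cos θ, Real.sin θ⟩ : ℂ) = Complex.cos θ + Complex.sin θ * Complex.I := by
    apply Complex.ext <;> simp [← Complex.ofReal_cos, ← Complex.ofReal_sin]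
  simp only [arcIndex, circlePoint]
  congr 4
  simpa [this] using Complex.arg_cos_add_sin_mul_I h

theorem arcIndex_mem (k : ℕ) (hk : 1 ≤ k) (x : UnitCircle) : arcIndex k x ∈ Finset.Icc 1 k := by
  have h := Complex.arg_mem_Ioc ⟨x.1 0, x.1 1⟩
  have hpi := Real.pi_pos
  have hk' : (1 : ℝ) ≤ k := by exact_mod_cast hk
  rw [Finset.mem_Icc, arcIndex, Nat.one_le_ceil_iff, Nat.ceil_le]
  have h1 : 0 < Complex.arg ⟨x.1 0, x.1 1⟩ + Real.pi := by linarith [h.1]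
  refine ⟨by positivity, ?_⟩
  have : (Complex.arg ⟨x.1 0, x.1 1⟩ + Real.pi) / (2 * Real.pi) ≤ 1 := by
    rw [div_le_one (by positivity)]; linarith [h.2]
  nlinarith

theorem circleUniform_real_arcIndex {k j : ℕ} (hj : j ∈ Finset.Icc 1 k) :
    circleUniform.real (arcIndex k ⁻¹' {j}) = (k : ℝ)⁻¹ := by
  rw [Finset.mem_Icc] at hj
  have hpi := Real.pi_pos
  have hk : (0 : ℝ) < k := by exact_mod_cast (by omega : 0 < k)
  have hjk : (j : ℝ) ≤ k := by exact_mod_cast hj.2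
  have hj1 : (1 : ℝ) ≤ j := by exact_mod_cast hj.1
  have key : circlePoint ⁻¹' (arcIndex k ⁻¹' {j}) ∩ Ioo (-Real.pi) (-Real.pi + 2 * Real.pi) =
      Ioc (-Real.pi + 2 * Real.pi * (j - 1) / k) (-Real.pi + 2 * Real.pi * j / k) \ {Real.pi} := by
    have e : ∀ θ, θ ∈ Ioc (-Real.pi) Real.pi → (arcIndex k (circlePoint θ) = j ↔
        θ ∈ Ioc (-Real.pi + 2 * Real.pi * (j - 1) / k) (-Real.pi + 2 * Real.pi * j / k)) := by
      intro θ hθ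
      have e1 : -Real.pi + 2 * Real.pi * (j - 1) / k < θ ↔
          2 * Real.pi * (j - 1) / k < θ + Real.pi := by constructor <;> intro h <;> linarith
      have e2 : θ ≤ -Real.pi + 2 * Real.pi * j / k ↔
          θ + Real.pi ≤ 2 * Real.pi * j / k := by constructor <;> intro h <;> linarith
      rw [arcIndex_circlePoint k hθ, Nat.ceil_eq_iff (by omega), Nat.cast_sub hj.1, Nat.cast_one,
        mem_Ioc, e1, e2, div_mul_eq_mul_div, lt_div_iff₀ (by positivity),
        div_le_iff₀ (by positivity), div_lt_iff₀ hk, le_div_iff₀ hk, mul_comm (2 * Real.pi),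
        mul_comm (2 * Real.pi)]
    have b1 : 0 ≤ 2 * Real.pi * (j - 1) / k :=
      div_nonneg (mul_nonneg (by positivity) (by linarith)) hk.le
    have b2 : 2 * Real.pi * j / k ≤ 2 * Real.pi := by
      rw [div_le_iff₀ hk]; nlinarith
    ext θ
    constructor
    · rintro ⟨h, h1, h2⟩
      exact ⟨(e θ ⟨h1, by linarith⟩).1 h, by simp only [mem_singleton_iff]; linarith⟩
    · rintro ⟨h, hne⟩
      have h' : θ < Real.pi := lt_of_le_of_ne (by linarith [h.2]) hne
      exact ⟨(e θ ⟨by linarith [h.1], h'.le⟩).2 h, by linarith [h.1], by linarith⟩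
  rw [circleUniform_real_eq (-Real.pi) (measurable_arcIndex k (measurableSet_singleton j)), key,
    measureReal_def, measure_sdiff_null (by simp), Real.volume_Ioc, ENNReal.toReal_ofReal]
  · field_simp; ring
  · rw [add_sub_add_left_eq_sub, ← sub_div, ← mul_sub]
    exact div_nonneg (mul_nonneg (by positivity) (by linarith)) hk.le

/-- A homogeneous linear separator is constant on each of `k` equal arcs except for at most two,
those containing the two unit vectors orthogonal to its normal vector. -/
theorem exists_exceptional_arcs (k : ℕ) {h : UnitCircle → ℤ} (hh : h ∈ linearSeparators) :
    ∃ B : Finset ℕ, B.card ≤ 2 ∧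
      ∀ x y, arcIndex k x = arcIndex k y → arcIndex k x ∉ B → h x = h y := by
  obtain ⟨w, hw, rfl⟩ := hh
  obtain ⟨φ, hφ⟩ : ∃ φ, w = circlePoint φ :=
    ⟨_, congrArg Subtype.val (circlePoint_arg ⟨w, by simpa using hw⟩).symm⟩
  refine ⟨{arcIndex k (circlePoint (φ + Real.pi / 2)), arcIndex k (circlePoint (φ - Real.pi / 2))},
    Finset.card_le_two, fun x y hxy hB => ?_⟩
  set α := Complex.arg ⟨x.1 0, x.1 1⟩ with hα
  set β := Complex.arg ⟨y.1 0, y.1 1⟩ with hβ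
  have hαm : α ∈ Ioc (-Real.pi) Real.pi := Complex.arg_mem_Ioc _
  have hβm : β ∈ Ioc (-Real.pi) Real.pi := Complex.arg_mem_Ioc _
  have hx : circlePoint α = x := circlePoint_arg x
  have hy : circlePoint β = y := circlePoint_arg y
  -- every point between `x` and `y` lies in the same arc
  have hmono : Monotone fun θ : ℝ => ⌈(θ + Real.pi) / (2 * Real.pi) * k⌉₊ := by
    intro θ θ' h
    have := Real.pi_pos
    dsimp only
    gcongr
  have harc : ∀ z ∈ uIcc α β, arcIndex k (circlePoint z) = arcIndex k x := by
    intro z hz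
    have hzm : z ∈ Ioc (-Real.pi) Real.pi := ordConnected_Ioc.uIcc_subset hαm hβm hz
    have h1 : arcIndex k x = ⌈(α + Real.pi) / (2 * Real.pi) * k⌉₊ := by rw [hα]; rfl
    have h2 : arcIndex k x = ⌈(β + Real.pi) / (2 * Real.pi) * k⌉₊ := by rw [hxy, hβ]; rfl
    have h3 := hmono.image_uIcc_subset (mem_image_of_mem _ hz)
    simp only [← h1, ← h2, uIcc_self, mem_singleton_iff] at h3
    rw [arcIndex_circlePoint k hzm, h3]
  have hne : ∀ z ∈ uIcc α β, Real.cos (z - φ) ≠ 0 := by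
    intro z hz h0
    apply hB
    rw [← harc z hz]
    obtain ⟨n, hn⟩ := Real.cos_eq_zero_iff.1 h0
    have hper : Function.Periodic circlePoint (2 * Real.pi) := circlePoint_add_two_pi
    rcases Int.even_or_odd' n with ⟨m, rfl | rfl⟩
    · have : z = φ + Real.pi / 2 + m * (2 * Real.pi) := by push_cast at hn; linarith
      rw [this, hper.int_mul m]
      simp
    · have : z = φ - Real.pi / 2 + (m + 1 : ℤ) * (2 * Real.pi) := by push_cast at hn ⊢; linarith
      rw [this, hper.int_mul (m + 1)]
      simp
  have hcont : ContinuousOn (fun z => Real.cos (z - φ)) (uIcc α β) := by fun_prop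
  rw [linearSeparator_eq_iff, hφ, ← hx, ← hy, inner_circlePoint_circlePoint,
    inner_circlePoint_circlePoint]
  have hivt := intermediate_value_uIcc hcont
  by_contra hcon
  have h0 : (0 : ℝ) ∈ uIcc (Real.cos (α - φ)) (Real.cos (β - φ)) := by
    rw [mem_uIcc]
    by_contra h'
    apply hcon
    constructor <;> intro h <;> by_contra h'' <;> push Not at h'' <;>
      [exact h' (Or.inr ⟨h''.le, h⟩); exact h' (Or.inl ⟨h''.le, h⟩)]
  obtain ⟨z, hz, hz0⟩ := hivt h0
  exact hne z hz hz0

/-! ### Expected mistakes as a sum of error probabilities -/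

/-- The event that the learner errs on round `t`. -/
def Learner.mistakeSet {X : Type*} [MeasurableSpace X] {Ω : Type*} [MeasurableSpace Ω]
    (A : Learner X Ω) (h : ℕ → X → ℤ) (t : ℕ) : Set (Ω × (ℕ → X)) :=
  {p | A.prediction h p.1 p.2 t ≠ h t (p.2 t)}

theorem Learner.measurableSet_mistakeSet_param {X Ω Ξ : Type*} [MeasurableSpace X]
    [MeasurableSpace Ω] [MeasurableSpace Ξ] (A : Learner X Ω) {h : Ξ → ℕ → X → ℤ}
    (hm : ∀ t, 1 ≤ t → Measurable fun q : Ξ × X => h q.1 t q.2) {t : ℕ} (ht : 1 ≤ t) :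
    MeasurableSet {q : Ξ × (Ω × (ℕ → X)) | q.2 ∈ A.mistakeSet (h q.1) t} := by
  have hlabel : ∀ s, 1 ≤ s →
      Measurable fun q : Ξ × (Ω × (ℕ → X)) => h q.1 s (q.2.2 s) := fun s hs =>
    (hm s hs).comp (by fun_prop : Measurable fun q : Ξ × (Ω × (ℕ → X)) => (q.1, q.2.2 s))
  have hobs : Measurable fun q : Ξ × (Ω × (ℕ → X)) =>
      (fun i : Finset.Ico 1 t => (q.2.2 i, h q.1 i (q.2.2 i))) :=
    measurable_pi_lambda _ fun i =>
      Measurable.prodMk (by fun_prop) (hlabel i (Finset.mem_Ico.1 i.2).1)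
  have hpred : Measurable fun q : Ξ × (Ω × (ℕ → X)) => A.prediction (h q.1) q.2.1 q.2.2 t :=
    (A.measurable_classifier t).comp
      ((by fun_prop : Measurable fun q : Ξ × (Ω × (ℕ → X)) => q.2.1).prodMk
        (hobs.prodMk (by fun_prop)))
  exact (measurableSet_eq_fun hpred (hlabel t ht)).compl

theorem Learner.measurableSet_mistakeSet {X Ω : Type*} [MeasurableSpace X]
    [MeasurableSpace Ω] (A : Learner X Ω) {h : ℕ → X → ℤ}
    (hm : ∀ t, 1 ≤ t → Measurable (h t)) {t : ℕ} (ht : 1 ≤ t) :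
    MeasurableSet (A.mistakeSet h t) :=
  measurable_prodMk_left (x := ()) (A.measurableSet_mistakeSet_param (Ξ := Unit)
    (h := fun _ => h) (fun s hs => (hm s hs).comp measurable_snd) ht)

theorem Learner.expectedMistakes_eq_sum {X Ω : Type*} [MeasurableSpace X]
    [MeasurableSpace Ω] (A : Learner X Ω) (ν : Measure Ω) [IsProbabilityMeasure ν] (P : Measure X)
    [IsProbabilityMeasure P] {h : ℕ → X → ℤ} (hm : ∀ t, 1 ≤ t → Measurable (h t)) (T : ℕ) :
    A.expectedMistakes ν P h T = ∑ t ∈ Finset.Icc 1 T,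
      (ν.prod (Measure.infinitePi fun _ : ℕ => P)).real (A.mistakeSet h t) := by
  have hite : ∀ (t : ℕ) (p : Ω × (ℕ → X)),
      (if A.prediction h p.1 p.2 t ≠ h t (p.2 t) then (1 : ℝ) else 0) =
        (A.mistakeSet h t).indicator 1 p := by
    intro t p
    by_cases hp : A.prediction h p.1 p.2 t ≠ h t (p.2 t) <;>
      simp [Learner.mistakeSet, indicator, hp]
  unfold Learner.expectedMistakes
  simp_rw [hite]
  rw [integral_finsetSum]
  · refine Finset.sum_congr rfl fun t ht => ?_
    exact integral_indicator_one (A.measurableSet_mistakeSet hm (Finset.mem_Icc.1 ht).1)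
  · intro t ht
    exact (integrable_const (1 : ℝ)).indicator
      (A.measurableSet_mistakeSet hm (Finset.mem_Icc.1 ht).1)

theorem isLittleO_natCast_iff {f : ℕ → ℝ} :
    f =o[atTop] (fun T : ℕ => (T : ℝ)) ↔ Tendsto (fun T : ℕ => f T / T) atTop (nhds 0) := by
  refine isLittleO_iff_tendsto' ?_
  filter_upwards [eventually_ge_atTop 1] with T hT h
  exact absurd h (by positivity)

theorem measurable_of_mem_linearSeparators {h : UnitCircle → ℤ} (hh : h ∈ linearSeparators) :
    Measurable h := by
  obtain ⟨w, -, rfl⟩ := hh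
  exact measurable_linearSeparator w

theorem isLittleO_sum_Icc_one_iff (Δ : ℕ → ℝ) :
    (fun T : ℕ => ∑ t ∈ Finset.Icc 1 T, Δ t) =o[atTop] (fun T : ℕ => (T : ℝ)) ↔
      (fun T : ℕ => ∑ t ∈ Finset.Icc 2 T, Δ t) =o[atTop] (fun T : ℕ => (T : ℝ)) := by
  have hc : (fun _ : ℕ => Δ 1) =o[atTop] (fun T : ℕ => (T : ℝ)) :=
    isLittleO_const_left.2 (Or.inr (tendsto_norm_atTop_atTop.comp tendsto_natCast_atTop_atTop))
  have he : (fun T : ℕ => ∑ t ∈ Finset.Icc 1 T, Δ t) =ᶠ[atTop]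
      fun T : ℕ => Δ 1 + ∑ t ∈ Finset.Icc 2 T, Δ t := by
    filter_upwards [eventually_ge_atTop 1] with T hT
    exact (Finset.add_sum_Ioc_eq_sum_Icc hT).symm
  rw [isLittleO_congr he EventuallyEq.rfl]
  exact ⟨fun h => by simpa using h.sub hc, fun h => hc.add h⟩

/-! ### Randomly rotating targets -/

/-- A fair coin. -/
noncomputable def fairCoin : Measure Bool :=
  (2⁻¹ : ENNReal) • (Measure.dirac false + Measure.dirac true)

instance isProbabilityMeasure_fairCoin : IsProbabilityMeasure fairCoin := by
  constructor
  simp [fairCoin, ENNReal.inv_two_add_inv_two]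

theorem fairCoin_map_not : fairCoin.map not = fairCoin := by
  have hm : Measurable not := measurable_of_finite _
  rw [fairCoin, Measure.map_smul, Measure.map_add _ _ hm, Measure.map_dirac' hm,
    Measure.map_dirac' hm, add_comm]
  rfl

/-- Flip the `t`-th coin of a sequence. -/
def flipAt (t : ℕ) (ξ : ℕ → Bool) : ℕ → Bool :=
  fun i => (if i = t then not else id) (ξ i)

theorem measurePreserving_flipAt (t : ℕ) :
    MeasurePreserving (flipAt t) (Measure.infinitePi fun _ : ℕ => fairCoin)
      (Measure.infinitePi fun _ : ℕ => fairCoin) := by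
  have hm : ∀ i : ℕ, Measurable (if i = t then not else id : Bool → Bool) :=
    fun i => measurable_of_finite _
  refine ⟨measurable_pi_lambda _ fun i => (hm i).comp (measurable_pi_apply i), ?_⟩
  have h := Measure.infinitePi_map_pi (μ := fun _ : ℕ => fairCoin) hm
  refine Eq.trans h ?_
  congr 1
  funext i
  split_ifs
  · exact fairCoin_map_not
  · exact Measure.map_id

/-- The angle, on round `t`, of the normal vector that rotates by `πΔ_r` on each round `r ≤ t`
whose coin shows `true`. -/
noncomputable def coinAngle (Δ : ℕ → ℝ) (ξ : ℕ → Bool) (t : ℕ) : ℝ :=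
  ∑ r ∈ Finset.Icc 2 t, if ξ r then Real.pi * Δ r else 0

/-- The target sequence driven by the coins `ξ`. -/
noncomputable def coinTarget (Δ : ℕ → ℝ) (ξ : ℕ → Bool) (t : ℕ) : UnitCircle → ℤ :=
  linearSeparator (circlePoint (coinAngle Δ ξ t))

theorem coinAngle_succ (Δ : ℕ → ℝ) (ξ : ℕ → Bool) {t : ℕ} (ht : 1 ≤ t) :
    coinAngle Δ ξ (t + 1) =
      coinAngle Δ ξ t + if ξ (t + 1) then Real.pi * Δ (t + 1) else 0 :=
  Finset.sum_Icc_succ_top (by omega) _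

theorem coinAngle_flipAt_of_lt (Δ : ℕ → ℝ) (ξ : ℕ → Bool) {s t : ℕ} (h : s < t) :
    coinAngle Δ (flipAt t ξ) s = coinAngle Δ ξ s := by
  refine Finset.sum_congr rfl fun r hr => ?_
  have : r ≠ t := by rw [Finset.mem_Icc] at hr; omega
  simp [flipAt, this]

theorem coinTarget_mem_driftClass {Δ : ℕ → ℝ} (hΔ : ∀ t, 2 ≤ t → Δ t ∈ Icc (0 : ℝ) 1)
    (ξ : ℕ → Bool) : coinTarget Δ ξ ∈ driftClass circleUniform linearSeparators Δ := by
  refine ⟨fun t _ => ⟨_, norm_eq_of_mem_sphere _, rfl⟩, fun t ht => ?_⟩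
  have hd := hΔ (t + 1) (by omega)
  unfold coinTarget
  rw [coinAngle_succ Δ ξ ht]
  split_ifs
  · exact (circleUniform_real_linearSeparator_ne _ hd.1 hd.2).le
  · simpa using hd.1

theorem circleUniform_real_coinTarget_flipAt {Δ : ℕ → ℝ}
    (hΔ : ∀ t, 2 ≤ t → Δ t ∈ Icc (0 : ℝ) 1) (ξ : ℕ → Bool) {t : ℕ} (ht : 2 ≤ t) :
    circleUniform.real {x | coinTarget Δ ξ t x ≠ coinTarget Δ (flipAt t ξ) t x} = Δ t := by
  obtain ⟨s, rfl⟩ : ∃ s, t = s + 1 := ⟨t - 1, by omega⟩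
  have hd := hΔ (s + 1) ht
  have key := circleUniform_real_linearSeparator_ne (coinAngle Δ ξ s) hd.1 hd.2
  unfold coinTarget
  rw [coinAngle_succ Δ ξ (by omega), coinAngle_succ Δ _ (by omega),
    coinAngle_flipAt_of_lt Δ ξ (Nat.lt_succ_self s)]
  have hf : flipAt (s + 1) ξ (s + 1) = !ξ (s + 1) := by simp [flipAt]
  rw [hf]
  cases ξ (s + 1)
  · simpa using key
  · simpa [ne_comm] using key

theorem measurable_coinTarget (Δ : ℕ → ℝ) (t : ℕ) :
    Measurable fun q : (ℕ → Bool) × UnitCircle => coinTarget Δ q.1 t q.2 := by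
  have hang : Measurable fun ξ : ℕ → Bool => coinAngle Δ ξ t := by
    refine Finset.measurable_sum _ fun r _ => ?_
    exact (measurable_of_finite fun b : Bool => if b then Real.pi * Δ r else 0).comp
      (measurable_pi_apply r)
  have hw : Measurable fun q : (ℕ → Bool) × UnitCircle =>
      ((circlePoint (coinAngle Δ q.1 t) : EuclideanSpace ℝ (Fin 2)), q.2) :=
    (measurable_subtype_coe.comp (continuous_circlePoint.measurable.comp
      (hang.comp measurable_fst))).prodMk measurable_snd
  exact (measurable_uncurry_linearSeparator.comp hw :)

/-- Whatever the learner predicts, at least one of the two targets that differ by the `t`-th coin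
flip proves it wrong at every point where they disagree. -/
theorem le_mistake_add_mistake_flipAt {Δ : ℕ → ℝ} (hΔ : ∀ t, 2 ≤ t → Δ t ∈ Icc (0 : ℝ) 1)
    {Ω : Type*} [MeasurableSpace Ω] (ν : Measure Ω) [IsProbabilityMeasure ν]
    (A : Learner UnitCircle Ω) (ξ : ℕ → Bool) {t : ℕ} (ht : 2 ≤ t) :
    Δ t ≤ (ν.prod (Measure.infinitePi fun _ : ℕ => circleUniform)).real
        (A.mistakeSet (coinTarget Δ ξ) t) +
      (ν.prod (Measure.infinitePi fun _ : ℕ => circleUniform)).real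
        (A.mistakeSet (coinTarget Δ (flipAt t ξ)) t) := by
  have hmp : MeasurePreserving (fun p : Ω × (ℕ → UnitCircle) => p.2 t)
      (ν.prod (Measure.infinitePi fun _ : ℕ => circleUniform)) circleUniform :=
    (measurePreserving_eval_infinitePi (fun _ : ℕ => circleUniform) t).comp measurePreserving_snd
  have hD : MeasurableSet {x | coinTarget Δ ξ t x ≠ coinTarget Δ (flipAt t ξ) t x} :=
    (measurableSet_eq_fun (measurable_linearSeparator _) (measurable_linearSeparator _)).compl
  rw [← circleUniform_real_coinTarget_flipAt hΔ ξ ht,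
    ← hmp.measureReal_preimage hD.nullMeasurableSet]
  refine (measureReal_mono ?_).trans (measureReal_union_le _ _)
  intro p hp
  have hpred : A.prediction (coinTarget Δ (flipAt t ξ)) p.1 p.2 t =
      A.prediction (coinTarget Δ ξ) p.1 p.2 t := by
    unfold Learner.prediction
    congr 1
    funext i
    rw [coinTarget, coinAngle_flipAt_of_lt Δ ξ (Finset.mem_Ico.1 i.2).2]
    rfl
  by_contra hcon
  simp only [mem_union, Learner.mistakeSet, mem_ofPred_eq, not_or, not_not, hpred] at hcon
  exact hp (hcon.1.symm.trans hcon.2)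

/-- If some learner makes sublinearly many mistakes against every target sequence in the drift
class, then it does so on average over the coin-driven targets, against which it errs on round `t`
with probability at least `Δ_t / 2`. -/
theorem isLittleO_drift_of_sublinearMistakes {Δ : ℕ → ℝ}
    (hΔ : ∀ t, 2 ≤ t → Δ t ∈ Icc (0 : ℝ) 1)
    {Ω : Type*} [MeasurableSpace Ω] (ν : Measure Ω) [IsProbabilityMeasure ν]
    (A : Learner UnitCircle Ω)
    (hA : A.SublinearMistakes ν circleUniform (driftClass circleUniform linearSeparators Δ)) :
    (fun T : ℕ => ∑ t ∈ Finset.Icc 2 T, Δ t) =o[atTop] (fun T : ℕ => (T : ℝ)) := by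
  set ρ := Measure.infinitePi fun _ : ℕ => fairCoin with hρ
  set μ := ν.prod (Measure.infinitePi fun _ : ℕ => circleUniform) with hμ
  set f : ℕ → (ℕ → Bool) → ℝ := fun t ξ => μ.real (A.mistakeSet (coinTarget Δ ξ) t) with hf
  have hfm : ∀ t, 1 ≤ t → Measurable (f t) := fun t ht =>
    (measurable_measure_prodMk_left (A.measurableSet_mistakeSet_param (h := coinTarget Δ)
      (fun s _ => measurable_coinTarget Δ s) ht)).ennreal_toReal
  have hf1 : ∀ t ξ, ‖f t ξ‖ ≤ 1 := fun t ξ => by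
    rw [Real.norm_of_nonneg measureReal_nonneg]
    exact measureReal_le_one
  have hfi : ∀ t, 1 ≤ t → Integrable (f t) ρ := fun t ht =>
    Integrable.of_bound (hfm t ht).aestronglyMeasurable 1 (ae_of_all _ (hf1 t))
  have hhalf : ∀ t, 2 ≤ t → Δ t ≤ 2 * ∫ ξ, f t ξ ∂ρ := by
    intro t ht
    have hflip := measurePreserving_flipAt t
    have hfi' : Integrable (fun ξ => f t (flipAt t ξ)) ρ :=
      hflip.integrable_comp_of_integrable (hfi t (by omega))
    have he : ∫ ξ, f t (flipAt t ξ) ∂ρ = ∫ ξ, f t ξ ∂ρ := by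
      rw [← integral_map hflip.measurable.aemeasurable
        (hfm t (by omega)).aestronglyMeasurable, hflip.map_eq]
    calc Δ t = ∫ _, Δ t ∂ρ := by simp
      _ ≤ ∫ ξ, (f t ξ + f t (flipAt t ξ)) ∂ρ :=
        integral_mono (integrable_const _) ((hfi t (by omega)).add hfi')
          fun ξ => le_mistake_add_mistake_flipAt hΔ ν A ξ ht
      _ = 2 * ∫ ξ, f t ξ ∂ρ := by
        rw [integral_add (hfi t (by omega)) hfi', he, two_mul]
  have hlim : ∀ ξ, Tendsto (fun T : ℕ => (∑ t ∈ Finset.Icc 1 T, f t ξ) / T) atTop (nhds 0) := by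
    intro ξ
    refine (isLittleO_natCast_iff.1 (hA _ (coinTarget_mem_driftClass hΔ ξ))).congr fun T => ?_
    rw [A.expectedMistakes_eq_sum ν circleUniform (h := coinTarget Δ ξ)
      fun t _ => measurable_linearSeparator _]
  have hint : Tendsto (fun T : ℕ => ∫ ξ, (∑ t ∈ Finset.Icc 1 T, f t ξ) / T ∂ρ) atTop
      (nhds 0) := by
    have h := tendsto_integral_of_dominated_convergence (μ := ρ) (bound := fun _ => (1 : ℝ))
      (F := fun (T : ℕ) ξ => (∑ t ∈ Finset.Icc 1 T, f t ξ) / T) (f := fun _ => 0)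
      (fun T => ((Finset.measurable_sum _ fun t ht =>
        hfm t (Finset.mem_Icc.1 ht).1).div_const _).aestronglyMeasurable)
      (integrable_const _) (fun T => ae_of_all _ fun ξ => ?_) (ae_of_all _ hlim)
    · simpa using h
    · rw [norm_div, Real.norm_natCast]
      refine div_le_one_of_le₀ ((norm_sum_le _ _).trans ?_) (Nat.cast_nonneg T)
      exact (Finset.sum_le_sum fun t _ => hf1 t ξ).trans (by simp)
  rw [isLittleO_natCast_iff]
  have hint2 := hint.const_mul 2
  rw [mul_zero] at hint2
  refine squeeze_zero (fun T => div_nonneg (Finset.sum_nonneg fun t ht =>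
    (hΔ t (Finset.mem_Icc.1 ht).1).1) (Nat.cast_nonneg T)) (fun T => ?_) hint2
  rw [integral_div, integral_finsetSum _ fun t ht => hfi t (Finset.mem_Icc.1 ht).1,
    ← mul_div_assoc, Finset.mul_sum]
  gcongr
  calc ∑ t ∈ Finset.Icc 2 T, Δ t ≤ ∑ t ∈ Finset.Icc 2 T, 2 * ∫ ξ, f t ξ ∂ρ :=
        Finset.sum_le_sum fun t ht => hhalf t (Finset.mem_Icc.1 ht).1
    _ ≤ ∑ t ∈ Finset.Icc 1 T, 2 * ∫ ξ, f t ξ ∂ρ :=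
        Finset.sum_le_sum_of_subset_of_nonneg (Finset.Icc_subset_Icc_left (by norm_num))
          fun t _ _ => mul_nonneg zero_le_two (integral_nonneg fun ξ => measureReal_nonneg)

/-! ### The learner that remembers the latest label of each arc -/

open Classical in
/-- On round `t` the circle is cut into `k t` equal arcs, and a point is given the latest label
observed in its arc (`-1` if the arc has not been visited). The seed is ignored. -/
noncomputable def arcLearner (k : ℕ → ℕ) (Ω : Type*) [MeasurableSpace Ω] :
    Learner UnitCircle Ω where
  classifier t _ z x :=
    if ∃ s, arcIndex (k t) (z s).1 = arcIndex (k t) x ∧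
      (∀ r, s < r → arcIndex (k t) (z r).1 ≠ arcIndex (k t) x) ∧ (z s).2 = 1 then 1 else -1
  classifier_label t ω z x := by
    split_ifs <;> simp
  measurable_classifier t := by
    have hx : Measurable fun p : Ω × (Finset.Ico 1 t → UnitCircle × ℤ) × UnitCircle =>
        arcIndex (k t) p.2.2 := (measurable_arcIndex _).comp (by fun_prop)
    have hz : ∀ s, Measurable fun p : Ω × (Finset.Ico 1 t → UnitCircle × ℤ) × UnitCircle =>
        arcIndex (k t) (p.2.1 s).1 := fun s => (measurable_arcIndex _).comp (by fun_prop)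
    have hy : ∀ s, Measurable fun p : Ω × (Finset.Ico 1 t → UnitCircle × ℤ) × UnitCircle =>
        (p.2.1 s).2 := fun s => by fun_prop
    refine Measurable.ite ?_ measurable_const measurable_const
    simp only [ofPred_exists, ofPred_and, ofPred_forall]
    exact MeasurableSet.iUnion fun s => (measurableSet_eq_fun (hz s) hx).inter
      ((MeasurableSet.iInter fun r => MeasurableSet.iInter fun _ =>
        (measurableSet_eq_fun (hz r) hx).compl).inter (measurableSet_eq_fun (hy s)
          measurable_const))

/-- If the arc of `x t` was visited in the last `m` rounds and the labels of the visits in these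
rounds agree with the current target, which is constant on the arc, then `arcLearner` is right. -/
theorem arcLearner_prediction_eq {k : ℕ → ℕ} {Ω : Type*} [MeasurableSpace Ω]
    {h : ℕ → UnitCircle → ℤ} {t : ℕ} (hlab : ∀ x, h t x = 1 ∨ h t x = -1) {x : ℕ → UnitCircle}
    {m : ℕ} (hm : m < t) (ω : Ω)
    (hconst : ∀ y, arcIndex (k t) y = arcIndex (k t) (x t) → h t y = h t (x t))
    (hvisit : ∃ s ∈ Finset.Ico (t - m) t, arcIndex (k t) (x s) = arcIndex (k t) (x t))
    (hdrift : ∀ s ∈ Finset.Ico (t - m) t, h s (x s) = h t (x s)) :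
    (arcLearner k Ω).prediction h ω x t = h t (x t) := by
  classical
  -- the latest visit
  obtain ⟨s, hs, hmax⟩ := ((Finset.Ico (t - m) t).filter
    fun s => arcIndex (k t) (x s) = arcIndex (k t) (x t)).exists_max_image id
      (by obtain ⟨s, hs⟩ := hvisit; exact ⟨s, Finset.mem_filter.2 hs⟩)
  rw [Finset.mem_filter] at hs
  obtain ⟨hs, hsx⟩ := hs
  have hs' := Finset.mem_Ico.1 hs
  have hlast : ∀ r : Finset.Ico 1 t, s < r → arcIndex (k t) (x r) ≠ arcIndex (k t) (x t) := by
    intro r hr hrx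
    have := hmax r (Finset.mem_filter.2
      ⟨Finset.mem_Ico.2 ⟨by omega, (Finset.mem_Ico.1 r.2).2⟩, hrx⟩)
    exact absurd hr (not_lt.2 this)
  have hval : h s (x s) = h t (x t) := (hdrift s hs).trans (hconst _ hsx)
  have hs1 : s ∈ Finset.Ico 1 t := Finset.mem_Ico.2 ⟨by omega, hs'.2⟩
  unfold Learner.prediction arcLearner
  dsimp only
  rcases hlab (x t) with h1 | h1
  · rw [if_pos, h1]
    exact ⟨⟨s, hs1⟩, hsx, hlast, hval.trans h1⟩
  · rw [if_neg, h1]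
    rintro ⟨s', hsx', hlast', hval'⟩
    have hss : (s' : ℕ) = s := by
      rcases lt_trichotomy (s' : ℕ) s with hlt | heq | hgt
      · exact absurd hsx (hlast' ⟨s, hs1⟩ hlt)
      · exact heq
      · exact absurd hsx' (hlast s' hgt)
    rw [hss, hval, h1] at hval'
    norm_num at hval'

/-- The arc of the `t`-th point is not visited in the preceding `m` rounds with probability
at most `(1 - 1/k) ^ m`, since the points are independent and each falls into a given arc with
probability `1/k`. -/
theorem measureReal_unvisited_le {k t m : ℕ} (hk : 1 ≤ k) (hm : m < t) :
    (Measure.infinitePi fun _ : ℕ => circleUniform).real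
      {x | ∀ s ∈ Finset.Ico (t - m) t, arcIndex k (x s) ≠ arcIndex k (x t)} ≤
        (1 - (k : ℝ)⁻¹) ^ m := by
  set μ := Measure.infinitePi fun _ : ℕ => circleUniform with hμ
  have hk0 : (k : ℝ) ≠ 0 := by positivity
  have hmeas : ∀ j, MeasurableSet (arcIndex k ⁻¹' {j}) :=
    fun j => measurable_arcIndex k (measurableSet_singleton j)
  let box : ℕ → ℕ → Set UnitCircle :=
    fun j s => if s = t then arcIndex k ⁻¹' {j} else (arcIndex k ⁻¹' {j})ᶜ
  have hbox : ∀ j ∈ Finset.Icc 1 k,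
      μ.real (Set.pi (insert t (Finset.Ico (t - m) t) : Finset ℕ) (box j)) =
        (k : ℝ)⁻¹ * (1 - (k : ℝ)⁻¹) ^ m := by
    intro j hj
    have hbm : ∀ s, MeasurableSet (box j s) := fun s => by
      dsimp only [box]
      split_ifs
      exacts [hmeas j, (hmeas j).compl]
    rw [measureReal_def, hμ, Measure.infinitePi_pi _ fun s _ => hbm s, ENNReal.toReal_prod,
      Finset.prod_insert Finset.right_notMem_Ico]
    congr 1
    · simpa [box, measureReal_def] using circleUniform_real_arcIndex hj
    · have hc : ∀ s ∈ Finset.Ico (t - m) t,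
          (circleUniform (box j s)).toReal = 1 - (k : ℝ)⁻¹ := by
        intro s hs
        have : s ≠ t := by rw [Finset.mem_Ico] at hs; omega
        simp only [box, if_neg this]
        rw [← measureReal_def, probReal_compl_eq_one_sub (hmeas j),
          circleUniform_real_arcIndex hj]
      rw [Finset.prod_congr rfl hc, Finset.prod_const, Nat.card_Ico]
      congr 1
      omega
  calc μ.real {x | ∀ s ∈ Finset.Ico (t - m) t, arcIndex k (x s) ≠ arcIndex k (x t)}
      ≤ μ.real (⋃ j ∈ Finset.Icc 1 k,
          Set.pi (insert t (Finset.Ico (t - m) t) : Finset ℕ) (box j)) := by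
        refine measureReal_mono (fun x hx => ?_) (measure_ne_top _ _)
        simp only [mem_iUnion]
        refine ⟨arcIndex k (x t), arcIndex_mem k hk _, fun s hs => ?_⟩
        rw [Finset.mem_coe, Finset.mem_insert] at hs
        rcases hs with rfl | hs
        · simp [box]
        · have : s ≠ t := by rw [Finset.mem_Ico] at hs; omega
          simpa [box, this] using hx s hs
    _ ≤ ∑ j ∈ Finset.Icc 1 k,
          μ.real (Set.pi (insert t (Finset.Ico (t - m) t) : Finset ℕ) (box j)) :=
        measureReal_biUnion_finset_le _ _
    _ = (1 - (k : ℝ)⁻¹) ^ m := by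
        rw [Finset.sum_congr rfl hbox, Finset.sum_const, Nat.card_Icc, nsmul_eq_mul]
        field_simp
        simp

/-- The error probability of `arcLearner` on round `t`: the arc of the `t`-th point is one of the
two exceptional ones, or was not visited lately, or the label of some recent point is outdated. -/
theorem measureReal_mistakeSet_arcLearner_le {k : ℕ → ℕ} {Ω : Type*} [MeasurableSpace Ω]
    (ν : Measure Ω) [IsProbabilityMeasure ν] {h : ℕ → UnitCircle → ℤ}
    (hh : ∀ t, 1 ≤ t → h t ∈ linearSeparators) {t m : ℕ} (hk : 1 ≤ k t) (hm : m < t) :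
    (ν.prod (Measure.infinitePi fun _ : ℕ => circleUniform)).real
        ((arcLearner k Ω).mistakeSet h t) ≤
      2 / k t + (1 - (k t : ℝ)⁻¹) ^ m +
        ∑ s ∈ Finset.Ico (t - m) t, circleUniform.real {x | h s x ≠ h t x} := by
  set μ := Measure.infinitePi fun _ : ℕ => circleUniform with hμ
  have hmeas : ∀ s, 1 ≤ s → Measurable (h s) :=
    fun s hs => measurable_of_mem_linearSeparators (hh s hs)
  have heval : ∀ s, MeasurePreserving (fun x : ℕ → UnitCircle => x s) μ circleUniform :=
    measurePreserving_eval_infinitePi (fun _ : ℕ => circleUniform)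
  have harc : ∀ j, MeasurableSet (arcIndex (k t) ⁻¹' {j}) :=
    fun j => measurable_arcIndex _ (measurableSet_singleton j)
  obtain ⟨B, hB2, hB⟩ := exists_exceptional_arcs (k t) (hh t (by omega))
  have hlab : ∀ x, h t x = 1 ∨ h t x = -1 := by
    obtain ⟨w, -, hw⟩ := hh t (by omega)
    rw [hw]
    exact linearSeparator_eq_one_or w
  set E₁ : Set (ℕ → UnitCircle) := ⋃ j ∈ B, (fun x => x t) ⁻¹' (arcIndex (k t) ⁻¹' {j})
  set E₂ : Set (ℕ → UnitCircle) :=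
    {x | ∀ s ∈ Finset.Ico (t - m) t, arcIndex (k t) (x s) ≠ arcIndex (k t) (x t)}
  set E₃ : Set (ℕ → UnitCircle) :=
    ⋃ s ∈ Finset.Ico (t - m) t, (fun x => x s) ⁻¹' {x | h s x ≠ h t x}
  have hE₁ : μ.real E₁ ≤ 2 / k t := by
    refine (measureReal_biUnion_finset_le _ _).trans ?_
    have hj : ∀ j ∈ B, μ.real ((fun x => x t) ⁻¹' (arcIndex (k t) ⁻¹' {j})) ≤ (k t : ℝ)⁻¹ := by
      intro j _
      rw [(heval t).measureReal_preimage (harc j).nullMeasurableSet]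
      by_cases hj : j ∈ Finset.Icc 1 (k t)
      · exact (circleUniform_real_arcIndex hj).le
      · have : arcIndex (k t) ⁻¹' {j} = ∅ :=
          Set.eq_empty_of_forall_notMem fun x hx => hj (hx ▸ arcIndex_mem _ hk x)
        rw [this, measureReal_empty]
        positivity
    refine (Finset.sum_le_card_nsmul _ _ _ hj).trans ?_
    rw [nsmul_eq_mul, div_eq_mul_inv]
    gcongr
    exact_mod_cast hB2
  have hE₃ : μ.real E₃ ≤
      ∑ s ∈ Finset.Ico (t - m) t, circleUniform.real {x | h s x ≠ h t x} := by
    refine (measureReal_biUnion_finset_le _ _).trans (Finset.sum_le_sum fun s hs => ?_)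
    rw [Finset.mem_Ico] at hs
    have hne : MeasurableSet {x | h s x ≠ h t x} :=
      (measurableSet_eq_fun (hmeas s (by omega)) (hmeas t (by omega))).compl
    rw [(heval s).measureReal_preimage hne.nullMeasurableSet]
  have hsub : (arcLearner k Ω).mistakeSet h t ⊆ univ ×ˢ (E₁ ∪ E₂ ∪ E₃) := by
    rintro ⟨ω, x⟩ hp
    refine ⟨mem_univ _, ?_⟩
    by_contra hcon
    simp only [mem_union, not_or] at hcon
    obtain ⟨⟨h₁, h₂⟩, h₃⟩ := hcon
    refine hp (arcLearner_prediction_eq hlab hm ω (fun y hy => hB _ _ hy fun hyB => ?_) ?_ ?_)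
    · refine h₁ (mem_iUnion₂.2 ⟨_, hyB, ?_⟩)
      exact hy.symm
    · by_contra hcon
      push Not at hcon
      exact h₂ hcon
    · intro s hs
      by_contra hcon
      exact h₃ (mem_iUnion₂.2 ⟨s, hs, hcon⟩)
  calc (ν.prod μ).real ((arcLearner k Ω).mistakeSet h t)
      ≤ (ν.prod μ).real (univ ×ˢ (E₁ ∪ E₂ ∪ E₃)) := measureReal_mono hsub
    _ = μ.real (E₁ ∪ E₂ ∪ E₃) := by rw [measureReal_prod_prod, probReal_univ, one_mul]
    _ ≤ μ.real E₁ + μ.real E₂ + μ.real E₃ :=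
        (measureReal_union_le _ _).trans (add_le_add_left (measureReal_union_le _ _) _)
    _ ≤ _ := add_le_add (add_le_add hE₁ (measureReal_unvisited_le hk hm)) hE₃

theorem measureReal_ne_le_sum_of_mem_driftClass {X : Type*} [MeasurableSpace X] {P : Measure X}
    [IsFiniteMeasure P] {C : Set (X → ℤ)} {Δ : ℕ → ℝ} {h : ℕ → X → ℤ}
    (hh : h ∈ driftClass P C Δ) {s t : ℕ} (hs : 1 ≤ s) (hst : s ≤ t) :
    P.real {x | h s x ≠ h t x} ≤ ∑ r ∈ Finset.Ioc s t, Δ r := by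
  induction t, hst using Nat.le_induction with
  | base => simp
  | succ t hst ih =>
    rw [Finset.sum_Ioc_succ_top hst]
    refine le_trans (measureReal_mono fun x hx => ?_)
      ((measureReal_union_le _ _).trans (add_le_add ih (hh.2 t (hs.trans hst))))
    by_contra hcon
    simp only [mem_union, mem_ofPred_eq, not_or, not_not] at hcon
    exact hx (hcon.1.trans hcon.2)

theorem sum_Ioc_sum_window_le {Δ : ℕ → ℝ} (hΔ : ∀ t, 2 ≤ t → 0 ≤ Δ t) (m T : ℕ) :
    ∑ t ∈ Finset.Ioc m T, ∑ r ∈ Finset.Ioc (t - m) t, Δ r ≤ m * ∑ r ∈ Finset.Icc 2 T, Δ r := by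
  rw [Finset.sum_comm' (t' := Finset.Icc 2 T)
    (s' := fun r => Finset.Ioc m T ∩ Finset.Ico r (r + m)), Finset.mul_sum]
  · refine Finset.sum_le_sum fun r hr => ?_
    rw [Finset.sum_const, nsmul_eq_mul]
    refine mul_le_mul_of_nonneg_right ?_ (hΔ r (Finset.mem_Icc.1 hr).1)
    have := Finset.card_le_card (Finset.inter_subset_right (s₁ := Finset.Ioc m T)
      (s₂ := Finset.Ico r (r + m)))
    rw [Nat.card_Ico, Nat.add_sub_cancel_left] at this
    exact_mod_cast this
  · intro t r
    simp only [Finset.mem_Ioc, Finset.mem_Icc, Finset.mem_inter, Finset.mem_Ico]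
    omega

/-- The mistake bound of `arcLearner`, with a free parameter `m`: how many of the latest rounds the
analysis looks at. -/
theorem arcLearner_expectedMistakes_le {Δ : ℕ → ℝ} (hΔ : ∀ t, 2 ≤ t → Δ t ∈ Icc (0 : ℝ) 1)
    {k : ℕ → ℕ} (hk1 : ∀ t, 1 ≤ k t) (hkm : Monotone k) {Ω : Type*} [MeasurableSpace Ω]
    (ν : Measure Ω) [IsProbabilityMeasure ν] {h : ℕ → UnitCircle → ℤ}
    (hh : h ∈ driftClass circleUniform linearSeparators Δ) (m T : ℕ) :
    (arcLearner k Ω).expectedMistakes ν circleUniform h T ≤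
      m + ∑ t ∈ Finset.range T, 2 / (k (t + 1) : ℝ) + T * (1 - (k T : ℝ)⁻¹) ^ m +
        m ^ 2 * ∑ t ∈ Finset.Icc 2 T, Δ t := by
  set μ := ν.prod (Measure.infinitePi fun _ : ℕ => circleUniform)
  set M : ℕ → ℝ := fun t => μ.real ((arcLearner k Ω).mistakeSet h t) with hM
  have hk0 : ∀ t, (1 : ℝ) ≤ k t := fun t => by exact_mod_cast hk1 t
  have hround : ∀ t ∈ Finset.Icc 1 T, M t ≤ (if t ≤ m then 1 else 0) + 2 / (k t : ℝ) +
      (1 - (k T : ℝ)⁻¹) ^ m + (if m < t then m * ∑ r ∈ Finset.Ioc (t - m) t, Δ r else 0) := by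
    intro t ht
    rw [Finset.mem_Icc] at ht
    have hq0 : 0 ≤ 1 - (k t : ℝ)⁻¹ := sub_nonneg.2 (inv_le_one_of_one_le₀ (hk0 t))
    have hqT : 1 - (k t : ℝ)⁻¹ ≤ 1 - (k T : ℝ)⁻¹ := by
      have := hk0 t
      have : (k t : ℝ) ≤ k T := by exact_mod_cast hkm ht.2
      gcongr
    by_cases hmt : t ≤ m
    · rw [if_pos hmt, if_neg (by omega)]
      have h1 : M t ≤ 1 := measureReal_le_one
      have h2 : 0 ≤ 2 / (k t : ℝ) := by positivity
      have h3 : 0 ≤ (1 - (k T : ℝ)⁻¹) ^ m := pow_nonneg (hq0.trans hqT) m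
      linarith
    · rw [if_neg hmt, if_pos (by omega), zero_add]
      refine (measureReal_mistakeSet_arcLearner_le ν hh.1 (hk1 t) (not_le.1 hmt)).trans ?_
      refine add_le_add (add_le_add le_rfl (pow_le_pow_left₀ hq0 hqT m)) ?_
      have hs : ∀ s ∈ Finset.Ico (t - m) t, circleUniform.real {x | h s x ≠ h t x} ≤
          ∑ r ∈ Finset.Ioc (t - m) t, Δ r := by
        intro s hs
        rw [Finset.mem_Ico] at hs
        refine (measureReal_ne_le_sum_of_mem_driftClass hh (by omega) hs.2.le).trans ?_
        refine Finset.sum_le_sum_of_subset_of_nonneg (Finset.Ioc_subset_Ioc_left hs.1)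
          fun r hr _ => (hΔ r ?_).1
        rw [Finset.mem_Ioc] at hr
        omega
      refine (Finset.sum_le_card_nsmul _ _ _ hs).trans (le_of_eq ?_)
      rw [Nat.card_Ico, nsmul_eq_mul]
      congr 2
      omega
  have hearly : ∑ t ∈ Finset.Icc 1 T, (if t ≤ m then (1 : ℝ) else 0) ≤ m := by
    rw [← Finset.sum_filter, Finset.sum_const, nsmul_eq_mul, mul_one]
    have : (Finset.Icc 1 T).filter (· ≤ m) ⊆ Finset.Icc 1 m := fun t ht => by
      simp only [Finset.mem_filter, Finset.mem_Icc] at ht ⊢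
      omega
    have := Finset.card_le_card this
    rw [Nat.card_Icc, Nat.add_sub_cancel] at this
    exact_mod_cast this
  have hlate : ∑ t ∈ Finset.Icc 1 T,
      (if m < t then m * ∑ r ∈ Finset.Ioc (t - m) t, Δ r else 0) ≤
        m ^ 2 * ∑ t ∈ Finset.Icc 2 T, Δ t := by
    have : (Finset.Icc 1 T).filter (m < ·) = Finset.Ioc m T := by
      ext t
      simp only [Finset.mem_filter, Finset.mem_Icc, Finset.mem_Ioc]
      omega
    rw [← Finset.sum_filter, this, ← Finset.mul_sum, sq, mul_assoc]
    exact mul_le_mul_of_nonneg_left (sum_Ioc_sum_window_le (fun t ht => (hΔ t ht).1) m T)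
      (Nat.cast_nonneg m)
  have harcs : ∑ t ∈ Finset.Icc 1 T, 2 / (k t : ℝ) = ∑ t ∈ Finset.range T, 2 / (k (t + 1) : ℝ) := by
    rw [Finset.range_eq_Ico, Finset.sum_Ico_add' (fun t => 2 / (k t : ℝ)) 0 T 1]
    rfl
  rw [(arcLearner k Ω).expectedMistakes_eq_sum ν circleUniform
    fun t ht => measurable_of_mem_linearSeparators (hh.1 t ht)]
  refine (Finset.sum_le_sum hround).trans ?_
  rw [Finset.sum_add_distrib, Finset.sum_add_distrib, Finset.sum_add_distrib, harcs,
    Finset.sum_const, Nat.card_Icc, Nat.add_sub_cancel, nsmul_eq_mul]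
  gcongr

/-! ### Refining the arcs slowly -/

/-- For every null sequence there is a monotone unbounded sequence of integers whose fourth power
grows slowly enough for the product to be null still. -/
theorem exists_monotone_pow_four_mul_tendsto_zero {a : ℕ → ℝ} (ha : Tendsto a atTop (nhds 0)) :
    ∃ k : ℕ → ℕ, Monotone k ∧ (∀ t, 1 ≤ k t) ∧ Tendsto k atTop atTop ∧
      Tendsto (fun T => (k T : ℝ) ^ 4 * a T) atTop (nhds 0) := by
  classical
  -- `p T j` says that from time `T` on the value `k = j + 1` makes `k ^ 4 * |a s|` at most `1 / k`.
  let p : ℕ → ℕ → Prop := fun T j => ∀ s, T ≤ s → |a s| ≤ 1 / ((j : ℝ) + 1) ^ 5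
  let g : ℕ → ℕ := fun T => Nat.findGreatest (p T) T
  have hp : ∀ j, ∃ N, p N j := by
    intro j
    have h0 : (0 : ℝ) < 1 / ((j : ℝ) + 1) ^ 5 := by positivity
    obtain ⟨N, hN⟩ := Metric.tendsto_atTop.1 ha _ h0
    exact ⟨N, fun s hs => by simpa using (hN s hs).le⟩
  have hg : Monotone g := fun T T' h =>
    Nat.findGreatest_mono (fun j hj s hs => hj s (h.trans hs)) h
  have hgt : Tendsto g atTop atTop := by
    refine tendsto_atTop_atTop_of_monotone hg fun j => ?_
    obtain ⟨N, hN⟩ := hp j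
    exact ⟨max N j, Nat.le_findGreatest (le_max_right _ _)
      fun s hs => hN s ((le_max_left _ _).trans hs)⟩
  have hk : Tendsto (fun T => g T + 1) atTop atTop := (tendsto_add_atTop_nat 1).comp hgt
  refine ⟨fun T => g T + 1, fun T T' h => Nat.add_le_add_right (hg h) 1, fun t => by simp, hk, ?_⟩
  refine squeeze_zero_norm' ?_ (tendsto_inv_atTop_nhds_zero_nat.comp hk)
  filter_upwards [hgt.eventually_ge_atTop 1] with T hT
  have hb : |a T| ≤ 1 / ((g T : ℝ) + 1) ^ 5 :=
    Nat.findGreatest_of_ne_zero (P := p T) rfl (by change g T ≠ 0; omega) T le_rfl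
  have h0 : (0 : ℝ) < (g T : ℝ) + 1 := by positivity
  simp only [Function.comp, Nat.cast_add, Nat.cast_one, norm_mul, norm_pow, Real.norm_eq_abs,
    abs_of_pos h0]
  calc ((g T : ℝ) + 1) ^ 4 * |a T| ≤ ((g T : ℝ) + 1) ^ 4 * (1 / ((g T : ℝ) + 1) ^ 5) := by gcongr
    _ = ((g T : ℝ) + 1)⁻¹ := by field_simp

theorem one_sub_inv_pow_sq_le {k : ℕ} (hk : 1 ≤ k) :
    (1 - (k : ℝ)⁻¹) ^ (k ^ 2) ≤ (k : ℝ)⁻¹ := by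
  have hk' : (1 : ℝ) ≤ k := by exact_mod_cast hk
  have h0 : 0 ≤ 1 - (k : ℝ)⁻¹ := sub_nonneg.2 (inv_le_one_of_one_le₀ hk')
  calc (1 - (k : ℝ)⁻¹) ^ (k ^ 2) ≤ Real.exp (-(k : ℝ)⁻¹) ^ (k ^ 2) :=
        pow_le_pow_left₀ h0 (Real.one_sub_le_exp_neg _) _
    _ = (Real.exp k)⁻¹ := by
        rw [← Real.exp_nat_mul, ← Real.exp_neg]
        congr 1
        push_cast
        field_simp
    _ ≤ (k : ℝ)⁻¹ := by
        gcongr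
        linarith [Real.add_one_le_exp (k : ℝ)]

/-- If the total drift is sublinear, then so is the expected number of mistakes of `arcLearner`,
when the number of arcs grows slowly. -/
theorem exists_arcLearner_sublinearMistakes {Δ : ℕ → ℝ}
    (hΔ : ∀ t, 2 ≤ t → Δ t ∈ Icc (0 : ℝ) 1)
    (hD : (fun T : ℕ => ∑ t ∈ Finset.Icc 2 T, Δ t) =o[atTop] (fun T : ℕ => (T : ℝ))) :
    ∃ k : ℕ → ℕ, ∀ (Ω : Type u) [MeasurableSpace Ω] (ν : Measure Ω) [IsProbabilityMeasure ν],
      (arcLearner k Ω).SublinearMistakes ν circleUniform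
        (driftClass circleUniform linearSeparators Δ) := by
  set D : ℕ → ℝ := fun T => ∑ t ∈ Finset.Icc 2 T, Δ t with hDdef
  have hD0 : ∀ T, 0 ≤ D T := fun T =>
    Finset.sum_nonneg fun t ht => (hΔ t (Finset.mem_Icc.1 ht).1).1
  have ha : Tendsto (fun T : ℕ => D T / T + (T : ℝ)⁻¹) atTop (nhds 0) := by
    simpa using (isLittleO_natCast_iff.1 hD).add tendsto_inv_atTop_nhds_zero_nat
  obtain ⟨k, hkm, hk1, hkt, hk⟩ := exists_monotone_pow_four_mul_tendsto_zero ha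
  refine ⟨k, fun Ω _ ν _ h hh => isLittleO_natCast_iff.2 ?_⟩
  have hkinv : Tendsto (fun T => ((k T : ℝ))⁻¹) atTop (nhds 0) :=
    tendsto_inv_atTop_nhds_zero_nat.comp hkt
  have hces : Tendsto (fun T : ℕ => (T : ℝ)⁻¹ * ∑ t ∈ Finset.range T, 2 / (k (t + 1) : ℝ)) atTop
      (nhds 0) := by
    refine Tendsto.cesaro ?_
    have := (hkinv.comp (tendsto_add_atTop_nat 1)).const_mul 2
    simpa [div_eq_mul_inv] using this
  have hlim := (hces.add hkinv).add hk
  simp only [add_zero] at hlim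
  refine squeeze_zero' (Eventually.of_forall fun T => ?_) ?_ hlim
  · rw [(arcLearner k Ω).expectedMistakes_eq_sum ν circleUniform
      fun t ht => measurable_of_mem_linearSeparators (hh.1 t ht)]
    exact div_nonneg (Finset.sum_nonneg fun t _ => measureReal_nonneg) (Nat.cast_nonneg T)
  · filter_upwards [eventually_ge_atTop 1] with T hT
    have hT0 : (0 : ℝ) < T := by exact_mod_cast hT
    have hkT : (1 : ℝ) ≤ k T := by exact_mod_cast hk1 T
    -- looking back `k T ^ 2` rounds makes unvisited arcs as rare as exceptional ones
    have hb := arcLearner_expectedMistakes_le hΔ hk1 hkm ν hh (k T ^ 2) T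
    rw [div_le_iff₀ hT0]
    refine hb.trans ?_
    have h1 := mul_le_mul_of_nonneg_left (one_sub_inv_pow_sq_le (hk1 T)) hT0.le
    have h2 : (k T : ℝ) ^ 2 ≤ (k T : ℝ) ^ 4 := pow_le_pow_right₀ hkT (by norm_num)
    have h3 : ((T : ℝ)⁻¹ * ∑ t ∈ Finset.range T, 2 / (k (t + 1) : ℝ) + (k T : ℝ)⁻¹ +
        (k T : ℝ) ^ 4 * (D T / T + (T : ℝ)⁻¹)) * T =
        ∑ t ∈ Finset.range T, 2 / (k (t + 1) : ℝ) + T * (k T : ℝ)⁻¹ +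
          (k T : ℝ) ^ 4 * (D T + 1) := by
      field_simp
    rw [h3]
    push_cast
    change (k T : ℝ) ^ 2 + _ + _ + ((k T : ℝ) ^ 2) ^ 2 * D T ≤ _
    rw [← pow_mul]
    linarith

/-! ### The equivalence -/

theorem theorem2 (Δ : ℕ → ℝ) (hΔ : ∀ t, 2 ≤ t → Δ t ∈ Icc (0 : ℝ) 1) :
    ((∃ A : Learner UnitCircle Unit,
        A.SublinearMistakes (Measure.dirac ()) circleUniform
          (driftClass circleUniform linearSeparators Δ)) ↔
      (fun T : ℕ => ∑ t ∈ Finset.Icc 1 T, Δ t) =o[atTop] (fun T : ℕ => (T : ℝ))) ∧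
    ((∃ (Ω : Type u) (_ : MeasurableSpace Ω) (ν : Measure Ω) (_ : IsProbabilityMeasure ν)
        (A : Learner UnitCircle Ω),
        A.SublinearMistakes ν circleUniform
          (driftClass circleUniform linearSeparators Δ)) ↔
      (fun T : ℕ => ∑ t ∈ Finset.Icc 1 T, Δ t) =o[atTop] (fun T : ℕ => (T : ℝ))) := by
  rw [isLittleO_sum_Icc_one_iff]
  refine ⟨⟨?_, fun hD => ?_⟩, ⟨?_, fun hD => ?_⟩⟩
  · rintro ⟨A, hA⟩
    exact isLittleO_drift_of_sublinearMistakes hΔ _ A hA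
  · obtain ⟨k, hk⟩ := exists_arcLearner_sublinearMistakes hΔ hD
    exact ⟨arcLearner k Unit, hk Unit _⟩
  · rintro ⟨Ω, _, ν, _, A, hA⟩
    exact isLittleO_drift_of_sublinearMistakes hΔ ν A hA
  · obtain ⟨k, hk⟩ := exists_arcLearner_sublinearMistakes hΔ hD
    exact ⟨PUnit, inferInstance, Measure.dirac PUnit.unit, inferInstance,
      arcLearner k PUnit, hk PUnit _⟩
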